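/- All graphs are finite, simple and undirected. For a connected graph $G$ let $D(G)$ be its distance matrix, whose $(u,v)$ entry is the length of a shortest path from $u$ to $v$, and let $\lambda_1(D(G))$ be the largest eigenvalue of $D(G)$. Let $c(G-S)$ be the number of connected components of the graph obtained from $G$ by deleting the vertex set $S$. The toughness of $G$ is $\tau(G)=\min\{|S|/c(G-S)\}$, the minimum being over all vertex cut sets $S$ (those with $c(G-S)\ge 2$), with $\tau(G)=\infty$ if $G$ is complete; $G$ is called $1$-tough if $\tau(G)\ge 1$. Write $+$ for disjoint union, $\vee$ for join, $K_m$ for the complete graph of order $m$, and $\delta K_1$ for the graph with $\delta$ vertices and no edges. **Theorem.** Let $G$ be a connected graph of order $n$ with minimum degree $\delta\ge 2$, where $n\ge \max\{8\delta,\ \tfrac12\delta^2+2\delta+2\}$. If $$\lambda_1(D(G))\le \lambda_1\bigl(D(K_\delta\vee(K_{n-2\delta}+\delta K_1))\bigr),$$ then $G$ is $1$-tough unless $G\cong K_\delta\vee(K_{n-2\delta}+\delta K_1)$, in which case $G$ is not $1$-tough. -/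

import Mathlib

open scoped ENNReal

noncomputable section

namespace SimpleGraph

/-- The distance matrix `D(G)`: the `(u, v)` entry is the distance from `u` to `v` in `G`. -/
def distMatrix {V : Type*} (G : SimpleGraph V) : Matrix V V ℝ :=
  Matrix.of fun u v => (G.dist u v : ℝ)

/-- The distance spectral radius `λ₁(D(G))`: the largest eigenvalue of the (real symmetric)
distance matrix of `G`. -/
def distSpectralRadius {V : Type*} [Fintype V] (G : SimpleGraph V) : ℝ :=
  sSup {μ : ℝ | ∃ x : V → ℝ, x ≠ 0 ∧ G.distMatrix.mulVec x = μ • x}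

/-- The number `c(G - S)` of connected components of the graph obtained from `G` by deleting the
vertices in `S`. -/
def numComponentsDelete {V : Type*} (G : SimpleGraph V) (S : Set V) : ℕ :=
  Nat.card (G.induce Sᶜ).ConnectedComponent

/-- `S` is a vertex cut set of `G`: deleting `S` leaves at least two components. -/
def IsVertexCutSet {V : Type*} (G : SimpleGraph V) (S : Set V) : Prop :=
  2 ≤ G.numComponentsDelete S

/-- The toughness `τ(G)` of a finite graph: the minimum of `|S| / c(G - S)` over all vertex cut
sets `S`. (A complete graph has no vertex cut set, and gets the customary value `∞`.) -/
def toughness {V : Type*} (G : SimpleGraph V) : ℝ≥0∞ :=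
  ⨅ (S : Set V) (_ : G.IsVertexCutSet S), (S.ncard : ℝ≥0∞) / (G.numComponentsDelete S : ℝ≥0∞)

/-- A graph is `t`-tough if its toughness is at least `t`. -/
def IsTough {V : Type*} (G : SimpleGraph V) (t : ℝ≥0∞) : Prop :=
  t ≤ G.toughness

/-- The join `G ∨ H`: the disjoint union of `G` and `H` together with all edges between
them. -/
def joinGraph {V W : Type*} (G : SimpleGraph V) (H : SimpleGraph W) : SimpleGraph (V ⊕ W) :=
  (G ⊕g H) ⊔ completeBipartiteGraph V W

/-- The graph `K_δ ∨ (K_{n-2δ} + δ K_1)`, of order `n` when `2 * δ ≤ n`. -/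
def extremalGraph (n δ : ℕ) : SimpleGraph (Fin δ ⊕ (Fin (n - 2 * δ) ⊕ Fin δ)) :=
  joinGraph (completeGraph (Fin δ))
    (completeGraph (Fin (n - 2 * δ)) ⊕g (⊥ : SimpleGraph (Fin δ)))

end SimpleGraph

end

/-! If `G` is not 1-tough, a cut `S` of size `s` leaves more than `s` components. Merging them into
`s + 1` classes of sizes `p i` bounds every distance below by `colorDist`. Fix `L` so that `L - 1`
bounds the extremal radius from above. Weight `S` by 1 and a class of size `p` by `(2L - s) / (L +
p)`. If the total weight `T = s + (2L - s) ∑ p i / (L + p i)` is at least `L`, this positive vector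
is subharmonic for `L - 1` (`sum_colorDist_mul_colorVec`). The spectral hypothesis then forces `T =
L` and equality of all distances (`dist_eq_of_distSpectralRadius_le`).

To see `T ≥ L`: `p / (L + p)` is concave and each part is at least `m = max 1 (δ - s + 1)` by
minimum degree, so `T` is smallest with `s` parts equal to `m` and one large part
(`sum_div_add_eq`). There `T - L` has the sign of a polynomial that is positive for `s ≠ δ`
(`balance_pos_of_lt`, `balance_pos_of_gt`) and zero for `s = δ`. Equality leaves only the extremal
graph. -/

namespace SimpleGraph

/-! ### Perron–Frobenius and Rayleigh bounds for the distance matrix. -/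

open Matrix in
/-- A nonnegative symmetric matrix with a positive superharmonic vector for `l` has no eigenvalue
above `l`. -/
theorem eigenvalue_le_of_mulVec_le {V : Type*} [Fintype V] {M : Matrix V V ℝ}
    (hM : M.IsSymm) (h0 : ∀ u v, 0 ≤ M u v) {x : V → ℝ} (hx : ∀ v, 0 < x v) {l : ℝ}
    (hl : ∀ v, (M *ᵥ x) v ≤ l * x v) {μ : ℝ} {y : V → ℝ} (hy : y ≠ 0)
    (hμ : M *ᵥ y = μ • y) : μ ≤ l := by
  obtain ⟨v₀, hv₀⟩ := Function.ne_iff.1 hy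
  have hpos : 0 < ∑ v, x v * |y v| :=
    Finset.sum_pos' (fun v _ => mul_nonneg (hx v).le (abs_nonneg _))
      ⟨v₀, Finset.mem_univ _, mul_pos (hx v₀) (abs_pos.2 hv₀)⟩
  have h1 : ∀ u, μ * |y u| ≤ ∑ v, M u v * |y v| := fun u => by
    have h2 : ∑ v, M u v * y v = μ * y u := congrFun hμ u
    calc μ * |y u| ≤ |μ| * |y u| := by gcongr; exact le_abs_self μ
      _ = |∑ v, M u v * y v| := by rw [h2, abs_mul]
      _ ≤ ∑ v, |M u v * y v| := Finset.abs_sum_le_sum_abs _ _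
      _ = ∑ v, M u v * |y v| := by
        refine Finset.sum_congr rfl fun v _ => ?_
        rw [abs_mul, abs_of_nonneg (h0 u v)]
  have h3 : μ * ∑ v, x v * |y v| ≤ l * ∑ v, x v * |y v| :=
    calc μ * ∑ v, x v * |y v| = ∑ u, x u * (μ * |y u|) := by
          rw [Finset.mul_sum]; exact Finset.sum_congr rfl fun u _ => by ring
      _ ≤ ∑ u, x u * ∑ v, M u v * |y v| :=
          Finset.sum_le_sum fun u _ => mul_le_mul_of_nonneg_left (h1 u) (hx u).le
      _ = ∑ v, |y v| * ∑ u, M v u * x u := by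
          simp only [Finset.mul_sum]
          rw [Finset.sum_comm]
          refine Finset.sum_congr rfl fun v _ => Finset.sum_congr rfl fun u _ => ?_
          rw [← hM.apply u v]; ring
      _ ≤ ∑ v, |y v| * (l * x v) :=
          Finset.sum_le_sum fun v _ => mul_le_mul_of_nonneg_left (hl v) (abs_nonneg _)
      _ = l * ∑ v, x v * |y v| := by
          rw [Finset.mul_sum]; exact Finset.sum_congr rfl fun u _ => by ring
  exact le_of_mul_le_mul_right h3 hpos

theorem distMatrix_isSymm {V : Type*} (G : SimpleGraph V) : G.distMatrix.IsSymm := by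
  ext u v
  simp [distMatrix, dist_comm]

theorem distMatrix_nonneg {V : Type*} (G : SimpleGraph V) (u v : V) : 0 ≤ G.distMatrix u v := by
  simp [distMatrix]

theorem distSpectralRadius_le {V : Type*} [Fintype V] (G : SimpleGraph V) {x : V → ℝ}
    (hx : ∀ v, 0 < x v) {l : ℝ} (hl0 : 0 ≤ l) (hl : ∀ v, (G.distMatrix.mulVec x) v ≤ l * x v) :
    G.distSpectralRadius ≤ l :=
  Real.sSup_le (fun _ ⟨_, hy, hμ⟩ =>
    eigenvalue_le_of_mulVec_le G.distMatrix_isSymm G.distMatrix_nonneg hx hl hy hμ) hl0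

theorem le_distSpectralRadius {V : Type*} [Fintype V] (G : SimpleGraph V) {μ : ℝ}
    {y : V → ℝ} (hy : y ≠ 0) (hμ : G.distMatrix.mulVec y = μ • y) : μ ≤ G.distSpectralRadius := by
  -- The real `sSup` needs a bound: the constant vector 1 is superharmonic for the sum of all
  -- entries.
  refine le_csSup ⟨∑ u, ∑ v, G.distMatrix u v, ?_⟩ ⟨y, hy, hμ⟩
  rintro ν ⟨z, hz, hν⟩
  refine eigenvalue_le_of_mulVec_le G.distMatrix_isSymm G.distMatrix_nonneg
    (x := fun _ => 1) (fun _ => one_pos) (fun u => ?_) hz hν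
  simp only [Matrix.mulVec, dotProduct, mul_one]
  exact Finset.single_le_sum (f := fun u => ∑ v, G.distMatrix u v)
    (fun u _ => Finset.sum_nonneg fun v _ => G.distMatrix_nonneg u v) (Finset.mem_univ u)

-- An eigenvalue `ν` of `r • 1 - D` gives the eigenvalue `r - ν ≤ r` of `D`, so `r • 1 - D` is
-- positive semidefinite.
open Matrix in
theorem dotProduct_mulVec_le_distSpectralRadius {V : Type*} [Fintype V] (G : SimpleGraph V)
    (y : V → ℝ) :
    y ⬝ᵥ (G.distMatrix *ᵥ y) ≤ G.distSpectralRadius * (y ⬝ᵥ y) := by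
  classical
  set r := G.distSpectralRadius
  have hH : (r • (1 : Matrix V V ℝ) - G.distMatrix).IsHermitian := by
    have h := G.distMatrix_isSymm
    rw [Matrix.IsHermitian, Matrix.conjTranspose_eq_transpose_of_trivial]
    simp [Matrix.transpose_sub, h.eq]
  have hP : (r • (1 : Matrix V V ℝ) - G.distMatrix).PosSemidef := by
    rw [hH.posSemidef_iff_eigenvalues_nonneg]
    intro i
    have h1 := hH.mulVec_eigenvectorBasis i
    have h2 : (WithLp.ofLp (hH.eigenvectorBasis i) : V → ℝ) ≠ 0 := fun h => by
      have := hH.eigenvectorBasis.orthonormal.ne_zero i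
      exact this (by ext j; exact congrFun h j)
    have h3 : G.distMatrix *ᵥ (WithLp.ofLp (hH.eigenvectorBasis i) : V → ℝ)
        = (r - hH.eigenvalues i) • (WithLp.ofLp (hH.eigenvectorBasis i) : V → ℝ) := by
      rw [Matrix.sub_mulVec, Matrix.smul_mulVec, Matrix.one_mulVec] at h1
      rw [sub_smul]
      rw [← h1]; abel
    have := G.le_distSpectralRadius h2 h3
    simp only [Pi.zero_apply]
    linarith
  have := hP.dotProduct_mulVec_nonneg y
  rw [Matrix.sub_mulVec, Matrix.smul_mulVec, Matrix.one_mulVec, dotProduct_sub,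
    dotProduct_smul, smul_eq_mul, star_trivial] at this
  linarith

/-- A positive subharmonic vector for `l ≥ λ₁` is harmonic. -/
theorem mulVec_eq_of_le_of_distSpectralRadius_le {V : Type*} [Fintype V] (G : SimpleGraph V)
    {y : V → ℝ} (hy : ∀ v, 0 < y v) {l : ℝ} (hl : ∀ v, l * y v ≤ (G.distMatrix.mulVec y) v)
    (hG : G.distSpectralRadius ≤ l) (v : V) : (G.distMatrix.mulVec y) v = l * y v := by
  by_contra hne
  have hlt : l * y v < (G.distMatrix.mulVec y) v := lt_of_le_of_ne (hl v) (Ne.symm hne)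
  have h1 : ∑ u, y u * (l * y u) < ∑ u, y u * (G.distMatrix.mulVec y) u :=
    Finset.sum_lt_sum (fun u _ => mul_le_mul_of_nonneg_left (hl u) (hy u).le)
      ⟨v, Finset.mem_univ v, mul_lt_mul_of_pos_left hlt (hy v)⟩
  have h2 := G.dotProduct_mulVec_le_distSpectralRadius y
  have h3 : G.distSpectralRadius * (y ⬝ᵥ y) ≤ l * (y ⬝ᵥ y) :=
    mul_le_mul_of_nonneg_right hG (Finset.sum_nonneg fun u _ => mul_self_nonneg _)
  have h4 : l * (y ⬝ᵥ y) = ∑ u, y u * (l * y u) := by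
    rw [dotProduct, Finset.mul_sum]; exact Finset.sum_congr rfl fun u _ => by ring
  have h5 : y ⬝ᵥ (G.distMatrix.mulVec y) = ∑ u, y u * (G.distMatrix.mulVec y) u := rfl
  linarith

end SimpleGraph

/-! ### Test vectors constant on colour classes. -/

namespace SimpleGraph

open scoped Classical in
/-- The distances in the complement of a complete multipartite graph on the coloured vertices:
differently coloured vertices are at distance `2`, all other pairs at distance `1`. -/
noncomputable def colorDist {V ι : Type*} (c : V → Option ι) (u v : V) : ℝ :=
  if u = v then 0 else if c u ≠ none ∧ c v ≠ none ∧ c u ≠ c v then 2 else 1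

/-- The number of vertices of colour `i`. -/
noncomputable def colorCard {V ι : Type*} (c : V → Option ι) (i : Option ι) : ℕ :=
  Nat.card {v // c v = i}

theorem sum_comp_eq_sum_colorCard {V ι : Type*} [Fintype V] [Fintype ι] (c : V → Option ι)
    (z : Option ι → ℝ) : ∑ v, z (c v) = ∑ i, (colorCard c i : ℝ) * z i := by
  classical
  rw [← Finset.sum_fiberwise Finset.univ c]
  refine Finset.sum_congr rfl fun i _ => ?_
  rw [Finset.sum_congr rfl (g := fun _ => z i) fun v hv => by rw [(Finset.mem_filter.1 hv).2],
    Finset.sum_const, nsmul_eq_mul, colorCard, Nat.card_eq_fintype_card, Fintype.card_subtype]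

theorem sum_ite_color {V ι : Type*} [Fintype V] (c : V → Option ι) (z : Option ι → ℝ)
    (i : Option ι) [DecidablePred fun v => c v = i] :
    ∑ v, (if c v = i then z (c v) else 0) = (colorCard c i : ℝ) * z i := by
  rw [← Finset.sum_filter,
    Finset.sum_congr rfl (g := fun _ => z i) fun v hv => by rw [(Finset.mem_filter.1 hv).2],
    Finset.sum_const, nsmul_eq_mul, colorCard, Nat.card_eq_fintype_card, Fintype.card_subtype]

theorem sum_colorDist_of_eq_none {V ι : Type*} [Fintype V] (c : V → Option ι) (z : Option ι → ℝ)
    {u : V} (hu : c u = none) :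
    ∑ v, colorDist c u v * z (c v) = ∑ v, z (c v) - z none := by
  classical
  have h : ∀ v, colorDist c u v * z (c v) = z (c v) - if u = v then z (c v) else 0 := fun v => by
    by_cases huv : u = v <;> simp [colorDist, huv, hu]
  simp [h, Finset.sum_sub_distrib, hu]

theorem sum_colorDist_of_eq_some {V ι : Type*} [Fintype V] (c : V → Option ι) (z : Option ι → ℝ)
    {u : V} {i : ι} (hu : c u = some i) :
    ∑ v, colorDist c u v * z (c v) = 2 * ∑ v, z (c v) - (colorCard c none : ℝ) * z none
      - (colorCard c (some i) : ℝ) * z (some i) - z (some i) := by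
  classical
  have h : ∀ v, colorDist c u v * z (c v) = 2 * z (c v) - (if c v = none then z (c v) else 0)
      - (if c v = some i then z (c v) else 0) - if u = v then z (c v) else 0 := fun v => by
    by_cases huv : u = v
    · subst huv
      simp [colorDist, hu]; ring
    · by_cases h1 : c v = none
      · simp [colorDist, huv, h1]; ring
      · by_cases h2 : c v = some i
        · simp [colorDist, huv, hu, h2]; ring
        · simp [colorDist, huv, h1, h2, hu, Ne.symm h2]
  simp only [h, Finset.sum_sub_distrib, sum_ite_color, ← Finset.mul_sum]
  simp [hu]

/-- The weights `1` on the uncoloured vertices and `(2L - s) / (L + p)` on a colour class of size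
`p`, where `s` is the number of uncoloured vertices. -/
noncomputable def colorVec {V ι : Type*} (c : V → Option ι) (L : ℝ) : Option ι → ℝ
  | none => 1
  | some i => (2 * L - colorCard c none) / (L + colorCard c (some i))

/-- The sum of all entries of the test vector given by `colorVec`. -/
noncomputable def colorTotal {V ι : Type*} [Fintype ι] (c : V → Option ι) (L : ℝ) : ℝ :=
  colorCard c none +
    (2 * L - colorCard c none) * ∑ i, (colorCard c (some i) : ℝ) / (L + colorCard c (some i))

theorem sum_colorVec {V ι : Type*} [Fintype V] [Fintype ι] (c : V → Option ι) (L : ℝ) :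
    ∑ v, colorVec c L (c v) = colorTotal c L := by
  rw [sum_comp_eq_sum_colorCard, Fintype.sum_option, colorTotal, Finset.mul_sum]
  simp only [colorVec, mul_one]
  congr 1
  exact Finset.sum_congr rfl fun i _ => by ring

theorem colorVec_pos {V ι : Type*} (c : V → Option ι) {L : ℝ} (hL0 : 0 < L)
    (hL : (colorCard c none : ℝ) < 2 * L) (i : Option ι) : 0 < colorVec c L i := by
  cases i with
  | none => exact one_pos
  | some i => exact div_pos (by linarith) (by positivity)

/-- On a class of size `p` the eigenvalue equation reads `(L + p) z = 2T - s`. The weights solve it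
with `L` in place of the total `T`, so the defect is a multiple of `T - L`. -/
theorem sum_colorDist_mul_colorVec {V ι : Type*} [Fintype V] [Fintype ι] (c : V → Option ι)
    {L : ℝ} (hL0 : 0 < L) (u : V) :
    ∑ v, colorDist c u v * colorVec c L (c v) = (L - 1) * colorVec c L (c u)
      + (if (c u).isNone then 1 else 2) * (colorTotal c L - L) := by
  cases hu : c u with
  | none =>
    rw [sum_colorDist_of_eq_none c _ hu, sum_colorVec]
    simp [colorVec]
  | some i =>
    rw [sum_colorDist_of_eq_some c _ hu, sum_colorVec]
    have h : (L + (colorCard c (some i) : ℝ)) ≠ 0 := by positivity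
    simp only [colorVec, Option.isNone_some, Bool.false_eq_true, if_false]
    field_simp
    ring

theorem distSpectralRadius_le_of_dist_le {V ι : Type*} [Fintype V] [Fintype ι]
    (G : SimpleGraph V) (c : V → Option ι) {L : ℝ} (hL1 : 1 ≤ L)
    (hL : (colorCard c none : ℝ) < 2 * L) (hT : colorTotal c L = L)
    (hd : ∀ u v, (G.dist u v : ℝ) ≤ colorDist c u v) : G.distSpectralRadius ≤ L - 1 := by
  have hpos := colorVec_pos c (by linarith) hL
  refine G.distSpectralRadius_le (x := fun v => colorVec c L (c v)) (fun v => hpos _)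
    (by linarith) fun u => ?_
  have h := sum_colorDist_mul_colorVec c (L := L) (by linarith) u
  rw [hT, sub_self, mul_zero, add_zero] at h
  rw [← h]
  exact Finset.sum_le_sum fun v _ => mul_le_mul_of_nonneg_right (hd u v) (hpos _).le

theorem dist_eq_of_distSpectralRadius_le {V ι : Type*} [Fintype V] [Fintype ι] [Nonempty V]
    (G : SimpleGraph V) (c : V → Option ι) {L : ℝ} (hL0 : 0 < L)
    (hL : (colorCard c none : ℝ) < 2 * L) (hT : L ≤ colorTotal c L)
    (hd : ∀ u v, colorDist c u v ≤ (G.dist u v : ℝ)) (hG : G.distSpectralRadius ≤ L - 1) :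
    colorTotal c L = L ∧ ∀ u v, (G.dist u v : ℝ) = colorDist c u v := by
  have hpos := colorVec_pos c hL0 hL
  have h1 : ∀ u, ∑ v, colorDist c u v * colorVec c L (c v)
      ≤ (G.distMatrix.mulVec fun v => colorVec c L (c v)) u := fun u =>
    Finset.sum_le_sum fun v _ => mul_le_mul_of_nonneg_right (hd u v) (hpos _).le
  have h2 : ∀ u, 1 * (colorTotal c L - L) ≤
      (if (c u).isNone then 1 else 2) * (colorTotal c L - L) := fun u =>
    mul_le_mul_of_nonneg_right (by split_ifs <;> norm_num) (by linarith)
  have h3 := fun u => sum_colorDist_mul_colorVec c hL0 u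
  have h4 := G.mulVec_eq_of_le_of_distSpectralRadius_le (fun v => hpos (c v))
    (fun u => by linarith [h1 u, h2 u, h3 u]) hG
  refine ⟨?_, fun u v => ?_⟩
  · obtain ⟨u⟩ := ‹Nonempty V›
    linarith [h1 u, h2 u, h3 u, h4 u]
  · have h5 : ∑ v, colorDist c u v * colorVec c L (c v)
        = ∑ v, (G.dist u v : ℝ) * colorVec c L (c v) :=
      le_antisymm (h1 u) ((h4 u).le.trans (by linarith [h2 u, h3 u]))
    have h6 := (Finset.sum_eq_sum_iff_of_le fun v _ =>
      mul_le_mul_of_nonneg_right (hd u v) (hpos (c v)).le).1 h5 v (Finset.mem_univ v)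
    exact (mul_right_cancel₀ (hpos (c v)).ne' h6).symm

end SimpleGraph

/-! ### Polynomial inequalities for the total weight. -/

/-- The cubic is `T = L` for class sizes `n - 2d, 1, …, 1` and `s = d`, cleared of denominators. Any
root in the interval will do, since its test vector is positive. -/
theorem exists_root_extremal {n d : ℝ} (hd : 2 ≤ d) (hn : 8 * d ≤ n) :
    ∃ L, n + d ≤ L ∧ L ≤ n + 3 * d ∧
      (L - n + d) * L * (L + 1) = d * (2 * L - d) * (L + n - 2 * d) := by
  have hc : ContinuousOn
      (fun L : ℝ => (L - n + d) * L * (L + 1) - d * (2 * L - d) * (L + n - 2 * d))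
      (Set.Icc (n + d) (n + 3 * d)) := by fun_prop
  have h1 : (n + d - n + d) * (n + d) * (n + d + 1)
      - d * (2 * (n + d) - d) * (n + d + n - 2 * d) ≤ 0 := by
    have : 0 ≤ d * ((n + d) * (2 * (n + d) - 2 - 8 * d) + 3 * d ^ 2) :=
      mul_nonneg (by linarith)
        (add_nonneg (mul_nonneg (by linarith) (by linarith)) (by positivity))
    linarith
  have h2 : 0 ≤ (n + 3 * d - n + d) * (n + 3 * d) * (n + 3 * d + 1)
      - d * (2 * (n + 3 * d) - d) * (n + 3 * d + n - 2 * d) := by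
    have : 0 ≤ d * ((n + 3 * d) * (4 + 12 * d) - 5 * d ^ 2) :=
      mul_nonneg (by linarith) (by nlinarith)
    linarith
  obtain ⟨L, ⟨h3, h4⟩, h5⟩ := intermediate_value_Icc (by linarith) hc ⟨h1, h2⟩
  exact ⟨L, h3, h4, by simpa [sub_eq_zero] using h5⟩

/-- The expression vanishes at `s = d` by `h`; subtracting `h` exposes the factor `s - d`. -/
theorem balance_pos_of_lt {n d L s : ℝ} (hd : 2 ≤ d) (hn : 8 * d ≤ n) (hL : n + d ≤ L)
    (h : (L - n + d) * L * (L + 1) = d * (2 * L - d) * (L + n - 2 * d))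
    (hs : d < s) (hsn : 2 * s + 1 ≤ n) :
    0 < s * (2 * L - s) * (L + n - 2 * s) - (L - n + s) * L * (L + 1) := by
  have h0 : s * (2 * L - s) * (L + n - 2 * s) - (L - n + s) * L * (L + 1)
      = (s - d) * (L * (L + 2 * n - 1 - 5 * (s + d)) - n * (s + d)
        + 2 * (s ^ 2 + s * d + d ^ 2)) := by linear_combination -h
  rw [h0]
  refine mul_pos (by linarith) ?_
  have h1 : 0 ≤ (n - 1 - 2 * s) * (5 * L + n - 2 * s - 2 * d) :=
    mul_nonneg (by linarith) (by linarith)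
  have h2 : 0 ≤ (L - n - d) * L := mul_nonneg (by linarith) (by linarith)
  have h3 : 0 ≤ (n - 8 * d) * L := mul_nonneg (by linarith) (by linarith)
  nlinarith

theorem balance_pos_of_gt {n d L s m : ℝ} (hd : 2 ≤ d) (hn : 8 * d ≤ n)
    (hn2 : d ^ 2 / 2 + 2 * d + 2 ≤ n) (hL : n + d ≤ L) (hL2 : L ≤ n + 3 * d)
    (h : (L - n + d) * L * (L + 1) = d * (2 * L - d) * (L + n - 2 * d))
    (hm : m = d - s + 1) (hs : s = 1 ∨ 2 ≤ s) (hsd : s < d) :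
    0 < s * m * (2 * L - s) * (L + n - s - s * m) - (L - n + s * m) * L * (L + m) := by
  subst hm
  have hs1 : 1 ≤ s := by rcases hs with h | h <;> linarith
  set φ := (2 * L - s) * (L + n - s - s * (d - s + 1)) with hφ
  -- Multiplying by `L + 1` lets `h` be subtracted, which exposes the factor `d - s`.
  have h0 : (s * (d - s + 1) * (2 * L - s) * (L + n - s - s * (d - s + 1))
        - (L - n + s * (d - s + 1)) * L * (L + (d - s + 1))) * (L + 1)
      = (d - s) * ((s - 1) * (L + 1) * (φ - L * (L + (d - s + 1)))
        + d * ((L + 1) * (L + n - 2 * d + (d - s) - (s - 1) * (d - s) - (2 * L - d) * (s - 2))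
          - (2 * L - d) * (L + n - 2 * d))) := by
    rw [hφ]
    linear_combination -(L + (d - s + 1)) * h
  have hL1 : 0 < L + 1 := by linarith
  refine pos_of_mul_pos_left (b := L + 1) ?_ hL1.le
  rw [h0]
  refine mul_pos (by linarith) ?_
  have h1 : (2 * L - d) * (L + n - 2 * d) ≤ (2 * (L + 1)) * (L + n - 2 * d) :=
    mul_le_mul_of_nonneg_right (by linarith) (by linarith)
  suffices h2 : d * (L + n - 2 * d + (s - 2) * (d - s + (2 * L - d)))
      < (s - 1) * (φ - L * (L + (d - s + 1))) by
    have h3 := mul_pos hL1 (sub_pos.2 h2)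
    have h4 := mul_le_mul_of_nonneg_left h1 (by linarith : 0 ≤ d)
    linarith
  rcases hs with rfl | hs
  · have : 0 < d * (L - n + 2 * d - 1) := mul_pos (by linarith) (by linarith)
    linarith
  · have h5 : L + n - 2 * d + (s - 2) * (d - s + (2 * L - d)) ≤ 2 * L * (s - 1) := by
      nlinarith
    have h6 : 2 * d * L < φ - L * (L + (d - s + 1)) := by
      have hq : 4 * (s * (d - s + 1)) ≤ (d + 1) ^ 2 := by nlinarith [sq_nonneg (d + 1 - 2 * s)]
      have h7 : (2 * L - s) * (2 * L - 3 * d - s - s * (d - s + 1)) ≤ φ :=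
        mul_le_mul_of_nonneg_left (by linarith) (by linarith)
      -- By `hq` the product term is at most `(d + 1) ^ 2 / 2`, which the quadratic bound `hn2`
      -- absorbs.
      have h8 : 0 < L * (3 * L - 8 * d - 4 * s - 2 * (s * (d - s + 1)) - (d - s + 1)) :=
        mul_pos (by linarith) (by nlinarith)
      have h9 : 0 ≤ s * (3 * d + s + s * (d - s + 1)) := by
        have : 0 ≤ s * (d - s + 1) := mul_nonneg (by linarith) (by linarith)
        exact mul_nonneg (by linarith) (by linarith)
      nlinarith
    have h10 := mul_lt_mul_of_pos_left h6 (by linarith : 0 < s - 1)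
    have h11 := mul_le_mul_of_nonneg_left h5 (by linarith : 0 ≤ d)
    linarith

/-- The chord of the concave function `p / (L + p)` between `m` and `X`, summed up. -/
theorem sum_div_add_eq {ι : Type*} [Fintype ι] {L s m X : ℝ} (p : ι → ℝ)
    (hι : (Fintype.card ι : ℝ) = s + 1) (hp : ∑ i, p i = X + s * m) (hLp : ∀ i, L + p i ≠ 0)
    (hLm : L + m ≠ 0) (hLX : L + X ≠ 0) :
    ∑ i, p i / (L + p i) = s * m / (L + m) + X / (L + X)
      + ∑ i, L * (p i - m) * (X - p i) / ((L + p i) * (L + m) * (L + X)) := by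
  -- The chord plus a remainder, nonnegative when `m ≤ p i ≤ X` and all quantities are positive.
  have h1 : ∀ i, p i / (L + p i) = m / (L + m) - L * m / ((L + m) * (L + X))
      + p i * (L / ((L + m) * (L + X)))
      + L * (p i - m) * (X - p i) / ((L + p i) * (L + m) * (L + X)) := fun i => by
    have := hLp i
    field_simp
    ring
  rw [Finset.sum_congr rfl fun i _ => h1 i, Finset.sum_add_distrib, Finset.sum_add_distrib,
    ← Finset.sum_mul, hp, Finset.sum_const, Finset.card_univ, nsmul_eq_mul, hι]
  field_simp
  ring

theorem chord_sub_eq {L n s m : ℝ} (hLm : L + m ≠ 0) (hLX : L + (n - s - s * m) ≠ 0) :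
    s + (2 * L - s) * (s * m / (L + m) + (n - s - s * m) / (L + (n - s - s * m))) - L
      = (s * m * (2 * L - s) * (L + n - s - s * m) - (L - n + s * m) * L * (L + m))
        / ((L + m) * (L + (n - s - s * m))) := by
  field_simp
  ring

/-! ### Colourings, the extremal graph and toughness. -/

namespace SimpleGraph

/-- Two vertices are separated by a partial colouring if both are coloured, with different
colours. -/
def Separated {V ι : Type*} (c : V → Option ι) (u v : V) : Prop :=
  c u ≠ none ∧ c v ≠ none ∧ c u ≠ c v

theorem colorDist_le_dist {V ι : Type*} {G : SimpleGraph V} (hG : G.Connected)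
    {c : V → Option ι} (hc : ∀ u v, Separated c u v → ¬ G.Adj u v) (u v : V) :
    colorDist c u v ≤ (G.dist u v : ℝ) := by
  unfold colorDist
  split_ifs with h1 h2
  · positivity
  · have h3 := hG.pos_dist_of_ne h1
    have h4 : G.dist u v ≠ 1 := fun h => hc u v h2 (dist_eq_one_iff_adj.1 h)
    exact_mod_cast (by omega : 2 ≤ G.dist u v)
  · exact_mod_cast hG.pos_dist_of_ne h1

theorem dist_le_colorDist {V ι : Type*} {G : SimpleGraph V} {c : V → Option ι}
    (hc : ∀ u v, G.Adj u v ↔ u ≠ v ∧ ¬ Separated c u v) {w : V} (hw : c w = none) (u v : V) :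
    (G.dist u v : ℝ) ≤ colorDist c u v := by
  unfold colorDist
  split_ifs with h1 h2
  · simp [h1]
  · have hu : G.Adj u w := (hc u w).2 ⟨fun h => h2.1 (h ▸ hw), fun h => h.2.1 hw⟩
    have hv : G.Adj w v := (hc w v).2 ⟨fun h => h2.2.1 (h ▸ hw), fun h => h.1 hw⟩
    exact_mod_cast dist_le (Walk.cons hu (Walk.cons hv Walk.nil))
  · have : G.dist u v = 1 := dist_eq_one_iff_adj.2 ((hc u v).2 ⟨h1, h2⟩)
    simp [this]

theorem adj_iff_of_dist_eq_colorDist {V ι : Type*} {G : SimpleGraph V} {c : V → Option ι}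
    (h : ∀ u v, (G.dist u v : ℝ) = colorDist c u v) (u v : V) :
    G.Adj u v ↔ u ≠ v ∧ ¬ Separated c u v := by
  rw [← dist_eq_one_iff_adj, ← Nat.cast_inj (R := ℝ), h, colorDist, Separated]
  split_ifs with h1 h2
  · simp [h1]
  · simp [h2]
  · simpa [h1] using h2

theorem nonempty_iso_of_colorCard_eq {V W ι : Type*} [Finite V] [Finite W] {G : SimpleGraph V}
    {H : SimpleGraph W} {c : V → Option ι} {c' : W → Option ι}
    (hc : ∀ u v, G.Adj u v ↔ u ≠ v ∧ ¬ Separated c u v)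
    (hc' : ∀ u v, H.Adj u v ↔ u ≠ v ∧ ¬ Separated c' u v)
    (h : ∀ i, colorCard c i = colorCard c' i) : Nonempty (G ≃g H) := by
  let e := Equiv.ofFiberEquiv (f := c) (g := c') fun i =>
    (Finite.card_eq.1 (h i)).some
  have he : ∀ v, c' (e v) = c v := Equiv.ofFiberEquiv_map _
  refine ⟨⟨e, fun {u v} => ?_⟩⟩
  rw [hc, hc', Separated, Separated, he, he, e.injective.ne_iff]

/-- The colouring of the extremal graph by its components outside the dominating clique. -/
def extremalColor (n d : ℕ) (i : Fin (d + 1)) :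
    Fin d ⊕ (Fin (n - 2 * d) ⊕ Fin d) → Option (Fin (d + 1))
  | Sum.inl _ => none
  | Sum.inr (Sum.inl _) => some i
  | Sum.inr (Sum.inr j) => some (i.succAbove j)

theorem extremalGraph_adj_iff (n d : ℕ) (i : Fin (d + 1))
    (u v : Fin d ⊕ (Fin (n - 2 * d) ⊕ Fin d)) :
    (extremalGraph n d).Adj u v ↔ u ≠ v ∧ ¬ Separated (extremalColor n d i) u v := by
  rcases u with u | u | u <;> rcases v with v | v | v <;>
    simp [extremalGraph, joinGraph, Separated, extremalColor, Fin.succAbove_ne,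
      (Fin.succAbove_ne _ _).symm]

theorem colorCard_extremalColor_none (n d : ℕ) (i : Fin (d + 1)) :
    colorCard (extremalColor n d i) none = d := by
  rw [colorCard, Nat.card_eq_fintype_card, Fintype.card_subtype, Finset.card_filter]
  simp [Fintype.sum_sum_type, extremalColor]

theorem colorCard_extremalColor_self (n d : ℕ) (i : Fin (d + 1)) :
    colorCard (extremalColor n d i) (some i) = n - 2 * d := by
  rw [colorCard, Nat.card_eq_fintype_card, Fintype.card_subtype, Finset.card_filter]
  simp [Fintype.sum_sum_type, extremalColor, Fin.succAbove_ne]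

theorem colorCard_extremalColor_succAbove (n d : ℕ) (i : Fin (d + 1)) (j : Fin d) :
    colorCard (extremalColor n d i) (some (i.succAbove j)) = 1 := by
  rw [colorCard, Nat.card_eq_fintype_card, Fintype.card_subtype, Finset.card_filter]
  simp [Fintype.sum_sum_type, extremalColor, (Fin.succAbove_ne _ _).symm]

theorem distSpectralRadius_extremalGraph_le {n d : ℕ} (hd : 1 ≤ d) (hn : 2 * d ≤ n) {L : ℝ}
    (hL : (d : ℝ) + 1 ≤ L)
    (h : (L - n + d) * L * (L + 1) = d * (2 * L - d) * (L + n - 2 * d)) :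
    (extremalGraph n d).distSpectralRadius ≤ L - 1 := by
  have hn' : (2 * d : ℝ) ≤ n := by exact_mod_cast hn
  have hd' : (1 : ℝ) ≤ d := by exact_mod_cast hd
  refine distSpectralRadius_le_of_dist_le _ (extremalColor n d 0) (by linarith) ?_ ?_
    (dist_le_colorDist (extremalGraph_adj_iff n d 0) (w := Sum.inl ⟨0, hd⟩) rfl)
  · rw [colorCard_extremalColor_none]; linarith
  · rw [colorTotal, Fin.sum_univ_succAbove _ 0]
    simp only [colorCard_extremalColor_none, colorCard_extremalColor_self,
      colorCard_extremalColor_succAbove, Finset.sum_const, Finset.card_univ, Fintype.card_fin,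
      nsmul_eq_mul, Nat.cast_one, Nat.cast_sub hn, Nat.cast_mul, Nat.cast_ofNat]
    have h1 := chord_sub_eq (L := L) (n := n) (s := d) (m := 1) (by linarith) (by linarith)
    have h2 : (n : ℝ) - d - d * 1 = n - 2 * d := by ring
    rw [h2] at h1
    have h3 : d * 1 * (2 * L - d) * (L + n - d - d * 1) - (L - n + d * 1) * L * (L + 1) = 0 := by
      linear_combination -h
    rw [h3, zero_div] at h1
    linear_combination h1

theorem colorCard_pos {V ι : Type*} [Finite V] {c : V → Option ι} {v : V} {i : Option ι}
    (hv : c v = i) : 1 ≤ colorCard c i :=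
  haveI : Nonempty {v // c v = i} := ⟨⟨v, hv⟩⟩
  Nat.card_pos

theorem sum_colorCard {V ι : Type*} [Fintype V] [Fintype ι] (c : V → Option ι) :
    colorCard c none + ∑ i, colorCard c (some i) = Fintype.card V := by
  have h := sum_comp_eq_sum_colorCard c fun _ => 1
  rw [Fintype.sum_option] at h
  simp only [Finset.sum_const, Finset.card_univ, nsmul_eq_mul, mul_one] at h
  exact_mod_cast h.symm

/-- All neighbours of `v` are uncoloured or share its colour; strictness comes from `v` itself. -/
theorem minDegree_lt_colorCard_add {V ι : Type*} [Fintype V] {G : SimpleGraph V}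
    [DecidableRel G.Adj] {c : V → Option ι} (hc : ∀ u v, Separated c u v → ¬ G.Adj u v) {i : ι}
    {v : V} (hv : c v = some i) :
    G.minDegree < colorCard c none + colorCard c (some i) := by
  classical
  refine (G.minDegree_le_degree v).trans_lt ?_
  rw [← card_neighborFinset_eq_degree]
  simp only [colorCard, Nat.card_eq_fintype_card, Fintype.card_subtype]
  rw [← Finset.card_union_of_disjoint]
  · refine Finset.card_lt_card ((Finset.ssubset_iff_of_subset fun u hu => ?_).2
      ⟨v, by simp [hv], by simp⟩)
    rw [mem_neighborFinset] at hu
    by_contra hcon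
    simp only [Finset.mem_union, Finset.mem_filter, Finset.mem_univ, true_and, not_or] at hcon
    exact hc v u ⟨by simp [hv], hcon.1, by rw [hv]; exact Ne.symm hcon.2⟩ hu
  · rw [Finset.disjoint_filter]
    intro u _ h1 h2
    simp [h1] at h2

theorem exists_coloring_of_not_isTough {V : Type*} [Finite V] {G : SimpleGraph V}
    (hG : G.Connected) (h : ¬ G.IsTough 1) :
    ∃ s : ℕ, 1 ≤ s ∧ ∃ c : V → Option (Fin (s + 1)), colorCard c none = s ∧
      (∀ i, ∃ v, c v = some i) ∧ ∀ u v, Separated c u v → ¬ G.Adj u v := by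
  classical
  rw [IsTough, not_le, toughness, iInf_lt_iff] at h
  obtain ⟨S, h⟩ := h
  rw [iInf_lt_iff] at h
  obtain ⟨hS, h⟩ := h
  have hlt : S.ncard < G.numComponentsDelete S := by
    by_contra hge
    rw [not_lt] at hge
    refine absurd h (not_lt.2 ?_)
    rw [ENNReal.le_div_iff_mul_le, one_mul]
    · exact_mod_cast hge
    · left
      unfold IsVertexCutSet at hS
      exact_mod_cast (by omega : G.numComponentsDelete S ≠ 0)
    · left; exact ENNReal.natCast_ne_top _
  -- Deleting nothing from a connected graph leaves one component, so `S` is nonempty.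
  have hS1 : 1 ≤ S.ncard := by
    by_contra h0
    have h1 : S = ∅ := (Set.ncard_eq_zero (Set.toFinite S)).1 (by omega)
    subst h1
    have h2 : (G.induce (∅ : Set V)ᶜ).Connected := by
      rw [Set.compl_empty]
      exact (induceUnivIso G).connected_iff.2 hG
    have := h2.preconnected.subsingleton_connectedComponent
    have h3 := Finite.card_le_one_iff_subsingleton.2 this
    unfold IsVertexCutSet numComponentsDelete at hS
    omega
  refine ⟨S.ncard, hS1, ?_⟩
  unfold numComponentsDelete at hlt
  have := Fintype.ofFinite (G.induce Sᶜ).ConnectedComponent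
  rw [Nat.card_eq_fintype_card] at hlt
  obtain ⟨g⟩ := Function.Embedding.nonempty_of_card_le (α := Fin (S.ncard + 1))
    (β := (G.induce Sᶜ).ConnectedComponent) (by simpa using hlt)
  -- `Function.invFun g` puts every component outside the range of `g` into one default class, so
  -- exactly `s + 1` colours are used.
  have hf := Function.invFun_surjective g.injective
  refine ⟨fun v => if hv : v ∈ Sᶜ then
    some (Function.invFun g ((G.induce Sᶜ).connectedComponentMk ⟨v, hv⟩)) else none, ?_, ?_, ?_⟩
  · refine (Nat.card_congr (Equiv.subtypeEquivRight fun v => ?_)).trans (Nat.card_coe_set_eq S)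
    simp
  · intro i
    obtain ⟨C, hC⟩ := hf i
    induction C using ConnectedComponent.ind with
    | _ v => exact ⟨v, by simp only [dif_pos v.2, hC]⟩
  · rintro u v ⟨hu, hv, huv⟩ hadj
    simp only [ne_eq, dite_eq_right_iff, reduceCtorEq, imp_false, not_not] at hu hv
    refine huv ?_
    simp only [hu, hv, dite_true]
    congr 2
    exact ConnectedComponent.sound
      (Adj.reachable (show (G.induce Sᶜ).Adj ⟨u, hu⟩ ⟨v, hv⟩ from hadj))

/-- Colours are constant along walks avoiding the uncoloured set, so the components map onto the `s
+ 1` colours. -/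
theorem not_isTough_of_coloring {V : Type*} [Finite V] {G : SimpleGraph V} {s : ℕ} (hs : 1 ≤ s)
    (c : V → Option (Fin (s + 1))) (h0 : colorCard c none = s) (h1 : ∀ i, ∃ v, c v = some i)
    (h2 : ∀ u v, Separated c u v → ¬ G.Adj u v) : ¬ G.IsTough 1 := by
  set S : Set V := {v | c v = none} with hS
  have hcS : S.ncard = s := h0
  have hsome : ∀ v : (Sᶜ : Set V), (c v).isSome := fun v => Option.isSome_iff_ne_none.2 v.2
  let f : (G.induce Sᶜ).ConnectedComponent → Fin (s + 1) :=
    ConnectedComponent.lift (fun v => (c v).get (hsome v)) fun u v p _ => by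
      clear * - p h2
      induction p with
      | nil => rfl
      | @cons u w v h p ih =>
        rw [← ih]
        by_contra hne
        refine h2 u w ⟨u.2, w.2, fun he => hne ?_⟩ h
        simp [he]
  have hf : Function.Surjective f := fun i => by
    obtain ⟨v, hv⟩ := h1 i
    have hvS : v ∈ Sᶜ := by simp [hS, hv]
    exact ⟨(G.induce Sᶜ).connectedComponentMk ⟨v, hvS⟩, by simp [f, hv]⟩
  have hcard : s + 1 ≤ G.numComponentsDelete S := by
    have := Nat.card_le_card_of_surjective f hf
    simpa [numComponentsDelete] using this
  rw [IsTough, not_le, toughness]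
  refine (iInf₂_le S (show 2 ≤ G.numComponentsDelete S by omega)).trans_lt ?_
  rw [hcS, ENNReal.div_lt_iff, one_mul]
  · exact_mod_cast hcard
  · left; exact_mod_cast (by omega : G.numComponentsDelete S ≠ 0)
  · left; exact ENNReal.natCast_ne_top _

end SimpleGraph

/-! ### Extremal class sizes and the conclusion. -/

namespace SimpleGraph

theorem exists_part_bound {n d s L : ℝ} {ι : Type*} (p : ι → ℝ) (hd : 2 ≤ d) (hn : 8 * d ≤ n)
    (hn2 : d ^ 2 / 2 + 2 * d + 2 ≤ n) (hL : n + d ≤ L) (hL2 : L ≤ n + 3 * d)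
    (h : (L - n + d) * L * (L + 1) = d * (2 * L - d) * (L + n - 2 * d))
    (hs : s = 1 ∨ 2 ≤ s) (hsn : 2 * s + 1 ≤ n) (hp : ∀ i, 1 ≤ p i)
    (hpd : ∀ i, d + 1 ≤ s + p i) :
    ∃ m : ℝ, 1 ≤ m ∧ (∀ i, m ≤ p i) ∧ ((s = d ∧ m = 1) ∨
      0 < s * m * (2 * L - s) * (L + n - s - s * m) - (L - n + s * m) * L * (L + m)) := by
  rcases lt_trichotomy s d with hsd | hsd | hsd
  · exact ⟨d - s + 1, by linarith, fun i => by linarith [hpd i],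
      Or.inr (balance_pos_of_gt hd hn hn2 hL hL2 h rfl hs hsd)⟩
  · exact ⟨1, le_rfl, hp, Or.inl ⟨hsd, rfl⟩⟩
  · refine ⟨1, le_rfl, hp, Or.inr ?_⟩
    have := balance_pos_of_lt hd hn hL h hsd hsn
    linarith

/-- Class sizes determine the graph. The index `i` is free because the large class may carry any
colour. -/
theorem nonempty_iso_extremalGraph {V : Type*} [Fintype V] {G : SimpleGraph V} {n d : ℕ}
    (hcard : Fintype.card V = n) (c : V → Option (Fin (d + 1)))
    (h0 : colorCard c none = d) (hc : ∀ u v, G.Adj u v ↔ u ≠ v ∧ ¬ Separated c u v)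
    (i : Fin (d + 1)) (hi : ∀ j, colorCard c (some (i.succAbove j)) = 1) :
    Nonempty (G ≃g extremalGraph n d) := by
  refine nonempty_iso_of_colorCard_eq hc (extremalGraph_adj_iff n d i) fun k => ?_
  have hsum := sum_colorCard c
  rw [Fin.sum_univ_succAbove _ i] at hsum
  simp only [hi, Finset.sum_const, Finset.card_univ, Fintype.card_fin, smul_eq_mul,
    mul_one] at hsum
  cases k with
  | none => rw [h0, colorCard_extremalColor_none]
  | some k =>
    rcases eq_or_ne k i with rfl | hk
    · rw [colorCard_extremalColor_self]; omega
    · obtain ⟨j, rfl⟩ := Fin.exists_succAbove_eq hk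
      rw [hi, colorCard_extremalColor_succAbove]

theorem nonempty_iso_of_coloring {V : Type*} [Fintype V] (G : SimpleGraph V)
    [DecidableRel G.Adj] {n d s : ℕ} (hconn : G.Connected) (hcard : Fintype.card V = n)
    (hmin : G.minDegree = d) (hd : 2 ≤ d) (hn : 8 * (d : ℝ) ≤ n)
    (hn2 : (d : ℝ) ^ 2 / 2 + 2 * d + 2 ≤ n)
    (hspec : G.distSpectralRadius ≤ (extremalGraph n d).distSpectralRadius)
    (hs : 1 ≤ s) (c : V → Option (Fin (s + 1))) (h0 : colorCard c none = s)
    (h1 : ∀ i, ∃ v, c v = some i) (h2 : ∀ u v, Separated c u v → ¬ G.Adj u v) :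
    Nonempty (G ≃g extremalGraph n d) := by
  have hd' : (2 : ℝ) ≤ d := by exact_mod_cast hd
  have hs' : (1 : ℝ) ≤ s := by exact_mod_cast hs
  obtain ⟨L, hL1, hL2, hL⟩ := exists_root_extremal hd' hn
  have hext := distSpectralRadius_extremalGraph_le (n := n) (d := d) (by omega)
    (by exact_mod_cast (by linarith : (2 * d : ℝ) ≤ n)) (by linarith) hL
  set p : Fin (s + 1) → ℝ := fun i => colorCard c (some i) with hp
  have hp1 : ∀ i, 1 ≤ p i := fun i => by
    obtain ⟨v, hv⟩ := h1 i
    simp only [hp]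
    exact_mod_cast colorCard_pos hv
  have hpd : ∀ i, (d : ℝ) + 1 ≤ s + p i := fun i => by
    obtain ⟨v, hv⟩ := h1 i
    have := minDegree_lt_colorCard_add h2 hv
    rw [hmin, h0] at this
    simp only [hp]
    exact_mod_cast this
  have hsum : s + ∑ i, p i = n := by
    have := sum_colorCard c
    rw [h0, hcard] at this
    simp only [hp]
    exact_mod_cast this
  have hsn : 2 * (s : ℝ) + 1 ≤ n := by
    have : ∑ _i : Fin (s + 1), (1 : ℝ) ≤ ∑ i, p i := Finset.sum_le_sum fun i _ => hp1 i
    simp at this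
    linarith
  obtain ⟨m, hm1, hmp, hB⟩ := exists_part_bound p hd' hn hn2 hL1 hL2 hL
    (hs.eq_or_lt.imp (fun h => by simp [← h]) fun h => by exact_mod_cast h) hsn hp1 hpd
  have hpX : ∀ i, p i ≤ n - s - s * m := fun i => by
    have h3 : ∑ j : Fin s, m ≤ ∑ j, p (i.succAbove j) := Finset.sum_le_sum fun j _ => hmp _
    rw [Fin.sum_univ_succAbove _ i] at hsum
    simp at h3
    linarith
  have hX1 := (hp1 0).trans (hpX 0)
  -- The concavity defect of each part, zero only when the part is `m` or the largest possible size.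
  set D : Fin (s + 1) → ℝ := fun i => L * (p i - m) * (n - s - s * m - p i)
    / ((L + p i) * (L + m) * (L + (n - s - s * m))) with hD
  have hL0 : 0 < L := by linarith
  have hden : ∀ i, 0 < (L + p i) * (L + m) * (L + (n - s - s * m)) := fun i =>
    mul_pos (mul_pos (by linarith [hp1 i]) (by linarith)) (by linarith)
  have hD0 : ∀ i, 0 ≤ D i := fun i =>
    div_nonneg (mul_nonneg (mul_nonneg hL0.le (by linarith [hmp i])) (by linarith [hpX i]))
      (hden i).le
  have hDs : 0 ≤ ∑ i, D i := Finset.sum_nonneg fun i _ => hD0 i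
  have hT : colorTotal c L - L
      = (s * m * (2 * L - s) * (L + n - s - s * m) - (L - n + s * m) * L * (L + m))
        / ((L + m) * (L + (n - s - s * m))) + (2 * L - s) * ∑ i, D i := by
    have h3 := sum_div_add_eq (s := s) (m := m) (X := n - s - s * m) p (by simp)
      (by linarith) (fun i => by linarith [hp1 i]) (by linarith : L + m ≠ 0) (by linarith)
    rw [← chord_sub_eq (by linarith) (by linarith), colorTotal, h0, h3]
    ring
  have hDs' : 0 ≤ (2 * L - s) * ∑ i, D i := mul_nonneg (by linarith) hDs
  have hden' : 0 < (L + m) * (L + (n - s - s * m)) := mul_pos (by linarith) (by linarith)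
  have : Nonempty V := hconn.nonempty
  have hdist := dist_eq_of_distSpectralRadius_le (L := L) G c hL0 (by rw [h0]; linarith)
  rcases hB with ⟨hsd, rfl⟩ | hB
  · have hB0 :
        s * 1 * (2 * L - s) * (L + n - s - s * 1) - (L - n + s * 1) * L * (L + 1) = 0 := by
      rw [hsd]; linear_combination -hL
    rw [hB0, zero_div, zero_add] at hT
    obtain ⟨h3, h4⟩ := hdist (by linarith) (colorDist_le_dist hconn h2) (by linarith)
    rw [h3, sub_self] at hT
    have h5 : ∑ i, D i = 0 := (mul_eq_zero.1 hT.symm).resolve_left (by linarith)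
    rw [Finset.sum_eq_zero_iff_of_nonneg fun i _ => hD0 i] at h5
    have h6 : ∀ i, p i ≠ 1 → p i = n - s - s := fun i hi => by
      have h7 := (div_eq_zero_iff.1 (h5 i (Finset.mem_univ i))).resolve_right (hden i).ne'
      have h8 := (mul_eq_zero.1 h7).resolve_left
        (mul_ne_zero hL0.ne' (sub_ne_zero.2 hi))
      linarith
    obtain rfl : s = d := by exact_mod_cast hsd
    -- If all parts were 1, then `n = 2s + 1`, against `n ≥ 8s`.
    obtain ⟨i, hi⟩ : ∃ i, p i ≠ 1 := by
      by_contra! hall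
      simp [hall] at hsum
      linarith
    refine nonempty_iso_extremalGraph hcard c h0 (adj_iff_of_dist_eq_colorDist h4) i fun j => ?_
    by_contra hj
    have hj' : p (i.succAbove j) = n - s - s :=
      h6 _ fun h => hj (by simp only [hp] at h; exact_mod_cast h)
    -- Two parts of size `n - 2s` would give `2(n - 2s) ≤ n - s`, that is `n ≤ 3s`.
    have h9 := Finset.add_le_sum (f := p) (s := Finset.univ) (fun k _ => by linarith [hp1 k])
      (Finset.mem_univ i) (Finset.mem_univ (i.succAbove j)) (Fin.succAbove_ne i j).symm
    linarith [h6 i hi]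
  -- Here `T > L` strictly, contradicting the forced `T = L`.
  · have hpos := div_pos hB hden'
    obtain ⟨h3, -⟩ := hdist (by linarith) (colorDist_le_dist hconn h2) (by linarith)
    linarith

theorem not_isTough_of_iso_extremalGraph {V : Type*} [Finite V] {G : SimpleGraph V} {n d : ℕ}
    (hd : 1 ≤ d) (hn : 2 * d < n) (e : G ≃g extremalGraph n d) : ¬ G.IsTough 1 := by
  refine not_isTough_of_coloring hd (fun v => extremalColor n d 0 (e v)) ?_ (fun i => ?_)
    fun u v huv hadj => ?_
  · exact (Nat.card_congr (e.toEquiv.subtypeEquiv fun v => Iff.rfl)).trans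
      (colorCard_extremalColor_none n d 0)
  · rcases eq_or_ne i 0 with rfl | hi
    · exact ⟨e.symm (Sum.inr (Sum.inl ⟨0, by omega⟩)), by simp [extremalColor]⟩
    · obtain ⟨j, rfl⟩ := Fin.exists_succAbove_eq hi
      exact ⟨e.symm (Sum.inr (Sum.inr j)), by simp [extremalColor]⟩
  · exact ((extremalGraph_adj_iff n d 0 _ _).1 (e.map_adj_iff.2 hadj)).2 huv

end SimpleGraph

theorem theorem1 {V : Type*} [Fintype V] (G : SimpleGraph V) [DecidableRel G.Adj] (n δ : ℕ)
    (hconn : G.Connected) (hcard : Fintype.card V = n) (hmin : G.minDegree = δ) (hδ : 2 ≤ δ)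
    (hn : max (8 * (δ : ℝ)) ((δ : ℝ) ^ 2 / 2 + 2 * (δ : ℝ) + 2) ≤ (n : ℝ))
    (hspec : G.distSpectralRadius ≤ (SimpleGraph.extremalGraph n δ).distSpectralRadius) :
    (¬ Nonempty (G ≃g SimpleGraph.extremalGraph n δ) → G.IsTough 1) ∧
      (Nonempty (G ≃g SimpleGraph.extremalGraph n δ) → ¬ G.IsTough 1) := by
  obtain ⟨hn1, hn2⟩ := max_le_iff.1 hn
  refine ⟨fun hiso => ?_, fun ⟨e⟩ => ?_⟩
  · by_contra htough
    obtain ⟨s, hs, c, h0, h1, h2⟩ := SimpleGraph.exists_coloring_of_not_isTough hconn htough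
    exact hiso (SimpleGraph.nonempty_iso_of_coloring G hconn hcard hmin hδ hn1 hn2 hspec hs c
      h0 h1 h2)
  · have hn' : 8 * δ ≤ n := by exact_mod_cast hn1
    exact SimpleGraph.not_isTough_of_iso_extremalGraph (by omega) (by omega) e
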